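/- Let $A$ and $B$ be unital semiprojective C*-algebras. (A separable C*-algebra $A$ is semiprojective if, whenever $D$ is a C*-algebra, $(J_n)$ is an increasing sequence of closed two-sided ideals of $D$ and $J=\overline{\bigcup_n J_n}$, every *-homomorphism $\phi:A\to D/J$ lifts, for some $n$, to a *-homomorphism $\psi:A\to D/J_n$, i.e. $\phi$ is the composition of $\psi$ with the quotient map $D/J_n\to D/J$.) Let $\mathcal G\subseteq A$ and $\mathcal H\subseteq B$ be sets of generators of the unital C*-algebras $A$ and $B$, each of which is finite or the set of terms of a sequence converging to $0$. For $\epsilon>0$ let $A\circledast_\epsilon B$ be the universal unital C*-algebra generated by unital copies of $A$ and $B$ such that $\|[a,b]\|\le\epsilon$ for all $a\in\mathcal G\cup\mathcal G^*$ and $b\in\mathcal H\cup\mathcal H^*$, and let $A\otimes B$ be the maximal tensor product, i.e. the universal unital C*-algebra generated by commuting copies of $A$ and $B$ with a common unit. Let $\pi_\epsilon:A\circledast_\epsilon B\to A\otimes B$ be the natural quotient map, and say that $\pi_\epsilon$ splits unitally if there is a unital *-homomorphism $\sigma:A\otimes B\to A\circledast_\epsilon B$ with $\pi_\epsilon\circ\sigma=\mathrm{id}$.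 Then the following are equivalent: 1. $\pi_\epsilon$ splits unitally for some $\epsilon>0$; 2. there is an $\epsilon_0>0$ such that $\pi_\epsilon$ splits unitally for every $\epsilon$ with $0<\epsilon\le\epsilon_0$; 3. $A\otimes B$ is semiprojective. -/

import Mathlib

open scoped ENNReal Topology

universe u

noncomputable section

/-- A closed two-sided ideal of a C*-algebra. -/
structure ClosedIdeal (D : Type u) [NonUnitalCStarAlgebra D] extends Submodule ℂ D where
  mul_mem_left' : ∀ x y : D, y ∈ carrier → x * y ∈ carrier
  mul_mem_right' : ∀ x y : D, x ∈ carrier → x * y ∈ carrier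
  isClosed' : IsClosed carrier

namespace ClosedIdeal

variable {D : Type u} [NonUnitalCStarAlgebra D]

instance : SetLike (ClosedIdeal D) D where
  coe J := J.carrier
  coe_injective := by
    rintro ⟨J, _, _, _⟩ ⟨K, _, _, _⟩ h
    obtain rfl : J = K := SetLike.coe_injective h
    rfl

instance : PartialOrder (ClosedIdeal D) := .ofSetLike (ClosedIdeal D) D

instance : AddSubgroupClass (ClosedIdeal D) D where
  add_mem {J} := J.toSubmodule.add_mem
  zero_mem J := J.toSubmodule.zero_mem
  neg_mem {J} := J.toSubmodule.neg_mem

instance : SMulMemClass (ClosedIdeal D) ℂ D where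
  smul_mem {J} := fun c _ => J.toSubmodule.smul_mem c

variable (J : ClosedIdeal D)

lemma mul_mem_left (x : D) {y : D} (hy : y ∈ J) : x * y ∈ J := J.mul_mem_left' x y hy
lemma mul_mem_right {x : D} (y : D) (hx : x ∈ J) : x * y ∈ J := J.mul_mem_right' x y hx
lemma isClosed : IsClosed (J : Set D) := J.isClosed'

instance : NonUnitalSubringClass (ClosedIdeal D) D where
  mul_mem {J} _ _ _ hy := J.mul_mem_left _ hy

/-- The function `min (|t| / δ) 1`. -/
def cut (δ t : ℝ) : ℝ := min (|t| / δ) 1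

lemma continuous_cut (δ : ℝ) : Continuous (cut δ) := by unfold cut; fun_prop
lemma cut_zero (δ : ℝ) : cut δ 0 = 0 := by simp [cut]

lemma cut_bound {δ : ℝ} (hδ : 0 < δ) (t : ℝ) : ‖t * (1 - cut δ t) ^ 2‖ ≤ δ := by
  unfold cut
  rw [norm_mul, Real.norm_eq_abs, norm_pow, Real.norm_eq_abs, sq_abs]
  have h0 : 0 ≤ |t| / δ := by positivity
  rcases le_total (|t| / δ) 1 with h | h
  · rw [min_eq_left h]
    have h1 : |t| ≤ δ := by rwa [div_le_one hδ] at h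
    have h2 : (1 - |t| / δ) ^ 2 ≤ 1 := by nlinarith
    nlinarith [abs_nonneg t]
  · rw [min_eq_right h]; simp [hδ.le]

/-- `J` contains an element that acts almost as a right unit on a given `x` with `star x * x ∈ J`. -/
lemma exists_approx (x : D) (hx : star x * x ∈ J) {ε : ℝ} (hε : 0 < ε) :
    ∃ e ∈ J, IsSelfAdjoint e ∧ ‖x - x * e‖ ≤ ε ∧ ∀ y : D, ‖y - y * e‖ ≤ ‖y‖ := by
  set u := star x * x with hu
  have hsa : IsSelfAdjoint u := IsSelfAdjoint.star_mul_self x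
  have hδ : 0 < ε ^ 2 := by positivity
  set δ := ε ^ 2
  have hc : Continuous (cut δ) := continuous_cut δ
  set e := cfcₙ (cut δ) u with he
  have hesa : IsSelfAdjoint e := cfcₙ_predicate _ _
  have husa : IsSelfAdjoint (u : Unitization ℂ D) := hsa.inr ℂ
  set w : Unitization ℂ D := cfc (fun t : ℝ => 1 - cut δ t) (u : Unitization ℂ D) with hw
  have hwe : w = 1 - (e : Unitization ℂ D) := by
    rw [he, Unitization.real_cfcₙ_eq_cfc_inr u (cut δ) (cut_zero δ), hw,
      cfc_sub (fun _ => (1 : ℝ)) (cut δ) (u : Unitization ℂ D) (by fun_prop) hc.continuousOn,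
      cfc_const_one ℝ (u : Unitization ℂ D)]
  have hy : ∀ y : D, ((y - y * e : D) : Unitization ℂ D) = y * w := by
    intro y
    rw [hwe, mul_sub, mul_one, Unitization.inr_sub, Unitization.inr_mul]
  have hwn : ‖w‖ ≤ 1 := by
    refine norm_cfc_le zero_le_one fun t _ => ?_
    have h0 : 0 ≤ cut δ t := le_min (by positivity) zero_le_one
    have h1 : cut δ t ≤ 1 := min_le_right _ _
    rw [Real.norm_eq_abs, abs_le]
    constructor <;> linarith
  refine ⟨e, ?_, hesa, ?_, fun y => ?_⟩
  · have hmem : e ∈ NonUnitalStarAlgebra.elemental ℝ u := cfcₙ_mem_elemental _ _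
    have hle : (NonUnitalStarAlgebra.elemental ℝ u : Set D) ⊆ J := by
      refine closure_minimal ?_ J.isClosed
      intro z hz
      have : z ∈ J ∧ star z ∈ J := by
        induction hz using NonUnitalStarAlgebra.adjoin_induction with
        | mem z hz =>
          obtain rfl : z = u := hz
          exact ⟨hx, by rwa [hsa.star_eq]⟩
        | add y z _ _ h1 h2 => exact ⟨add_mem h1.1 h2.1, by rw [star_add]; exact add_mem h1.2 h2.2⟩
        | zero => exact ⟨zero_mem J, by rw [star_zero]; exact zero_mem J⟩
        | mul y z _ _ h1 h2 => exact ⟨mul_mem h1.1 h2.1, by rw [star_mul]; exact mul_mem h2.2 h1.2⟩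
        | smul r y _ h =>
          have hr : ∀ z : D, r • z = (r : ℂ) • z := fun z => (Complex.coe_smul r z).symm
          exact ⟨by rw [hr]; exact SMulMemClass.smul_mem _ h.1,
            by rw [star_smul, star_trivial, hr]; exact SMulMemClass.smul_mem _ h.2⟩
        | star y _ h => exact ⟨h.2, by rw [star_star]; exact h.1⟩
      exact this.1
    exact hle hmem
  · have h2 : ‖x - x * e‖ ^ 2 ≤ ε ^ 2 := by
      rw [← Unitization.norm_inr (𝕜 := ℂ), hy, sq, ← CStarRing.norm_star_mul_self]
      have hws : star w = w := (cfc_predicate (R := ℝ) (p := IsSelfAdjoint) _ _ : IsSelfAdjoint w)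
      have : star ((x : Unitization ℂ D) * w) * (x * w)
          = cfc (fun t : ℝ => t * (1 - cut δ t) ^ 2) (u : Unitization ℂ D) := by
        rw [star_mul, hws]
        have h3 : w * star (x : Unitization ℂ D) * (x * w) = w * (u : Unitization ℂ D) * w := by
          rw [hu, Unitization.inr_mul, Unitization.inr_star]; simp only [mul_assoc]
        have hc' : ContinuousOn (fun t : ℝ => 1 - cut δ t)
          (spectrum ℝ (u : Unitization ℂ D)) := by fun_prop
        have h4 : w * (u : Unitization ℂ D) * w = w * cfc (id : ℝ → ℝ) (u : Unitization ℂ D) * w := by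
          rw [cfc_id ℝ (u : Unitization ℂ D)]
        rw [h3, h4, hw, ← cfc_mul _ _ _ hc' continuousOn_id, ← cfc_mul (fun t : ℝ => (1 - cut δ t) * id t) _ _ (hc'.mul continuousOn_id) hc']
        congr 1
        ext t
        simp only [id]
        ring
      rw [this]
      exact norm_cfc_le hδ.le fun t _ => cut_bound hδ t
    exact le_of_sq_le_sq h2 hε.le
  · rw [← Unitization.norm_inr (𝕜 := ℂ), hy]
    calc _ ≤ ‖(y : Unitization ℂ D)‖ * ‖w‖ := norm_mul_le _ _
      _ ≤ ‖(y : Unitization ℂ D)‖ * 1 := by gcongr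
      _ = ‖y‖ := by rw [mul_one, Unitization.norm_inr]

lemma star_mem {x : D} (hx : x ∈ J) : star x ∈ J := by
  rw [← SetLike.mem_coe, ← J.isClosed.closure_eq, Metric.mem_closure_iff]
  intro ε hε
  obtain ⟨e, he, hsa, hxe, -⟩ := J.exists_approx x (J.mul_mem_left _ hx) (half_pos hε)
  refine ⟨e * star x, J.mul_mem_right _ he, ?_⟩
  rw [dist_eq_norm, ← norm_star, star_sub, star_mul, star_star, hsa.star_eq]
  linarith

instance : StarMemClass (ClosedIdeal D) D where
  star_mem {J} _ h := J.star_mem h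

/-- The quotient `D / J`. It is made into a C*-algebra below: quotient norm, and the operations of
`D` on representatives. -/
def Quot : Type u := D ⧸ J.toSubmodule

instance : IsClosed (J.toSubmodule : Set D) := J.isClosed

namespace Quot

instance : NormedAddCommGroup J.Quot :=
  inferInstanceAs (NormedAddCommGroup (D ⧸ J.toSubmodule))

instance : NormedSpace ℂ J.Quot := inferInstanceAs (NormedSpace ℂ (D ⧸ J.toSubmodule))

instance : CompleteSpace J.Quot := inferInstanceAs (CompleteSpace (D ⧸ J.toSubmodule))

variable {J}

def mk (x : D) : J.Quot := Submodule.Quotient.mk x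

lemma mk_surjective : Function.Surjective (mk : D → J.Quot) := Submodule.Quotient.mk_surjective _

lemma mk_eq_mk {x y : D} : (mk x : J.Quot) = mk y ↔ x - y ∈ J := Submodule.Quotient.eq _

lemma mk_add (x y : D) : (mk (x + y) : J.Quot) = mk x + mk y := rfl
lemma mk_sub (x y : D) : (mk (x - y) : J.Quot) = mk x - mk y := rfl
lemma mk_zero : (mk 0 : J.Quot) = 0 := rfl
lemma mk_smul (c : ℂ) (x : D) : (mk (c • x) : J.Quot) = c • mk x := rfl
lemma norm_mk_le (x : D) : ‖(mk x : J.Quot)‖ ≤ ‖x‖ := Submodule.Quotient.norm_mk_le _ x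

lemma exists_norm_lt (x : J.Quot) {ε : ℝ} (hε : 0 < ε) : ∃ y : D, mk y = x ∧ ‖y‖ < ‖x‖ + ε :=
  Submodule.Quotient.norm_mk_lt x hε

instance : Mul J.Quot where
  mul := Quotient.map₂ (· * ·) fun a a' h b b' h' => by
    replace h := (Submodule.quotientRel_def _).1 h
    replace h' := (Submodule.quotientRel_def _).1 h'
    refine (Submodule.quotientRel_def _).2 ?_
    have : a * b - a' * b' = (a - a') * b + a' * (b - b') := by noncomm_ring
    change a * b - a' * b' ∈ J
    rw [this]
    exact add_mem (J.mul_mem_right _ h) (J.mul_mem_left _ h')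

instance : Star J.Quot where
  star := Quotient.map star fun a a' h => by
    replace h := (Submodule.quotientRel_def _).1 h
    refine (Submodule.quotientRel_def _).2 ?_
    change star a - star a' ∈ J
    rw [← star_sub]
    exact J.star_mem h

lemma mk_mul (x y : D) : (mk (x * y) : J.Quot) = mk x * mk y := rfl
lemma mk_star (x : D) : (mk (star x) : J.Quot) = star (mk x) := rfl

instance : NonUnitalRing J.Quot where
  left_distrib := by
    rintro ⟨a⟩ ⟨b⟩ ⟨c⟩; exact congrArg mk (mul_add a b c)
  right_distrib := by
    rintro ⟨a⟩ ⟨b⟩ ⟨c⟩; exact congrArg mk (add_mul a b c)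
  zero_mul := by rintro ⟨a⟩; exact congrArg mk (zero_mul a)
  mul_zero := by rintro ⟨a⟩; exact congrArg mk (mul_zero a)
  mul_assoc := by rintro ⟨a⟩ ⟨b⟩ ⟨c⟩; exact congrArg mk (mul_assoc a b c)

instance : StarRing J.Quot where
  star_involutive := by rintro ⟨a⟩; exact congrArg mk (star_star a)
  star_mul := by rintro ⟨a⟩ ⟨b⟩; exact congrArg mk (star_mul a b)
  star_add := by rintro ⟨a⟩ ⟨b⟩; exact congrArg mk (star_add a b)

instance : NonUnitalNormedRing J.Quot where
  dist_eq := dist_eq_norm_neg_add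
  norm_mul_le x y := by
    refine le_of_forall_pos_lt_add fun ε hε => ?_
    have hcont : Filter.Tendsto (fun δ : ℝ => (‖x‖ + δ) * (‖y‖ + δ)) (𝓝[>] 0)
        (𝓝 (‖x‖ * ‖y‖)) := by
      have : ContinuousAt (fun δ : ℝ => (‖x‖ + δ) * (‖y‖ + δ)) 0 := by fun_prop
      simpa using this.tendsto.mono_left nhdsWithin_le_nhds
    obtain ⟨δ, hlt, hδ⟩ := ((hcont.eventually_lt_const
      (lt_add_of_pos_right (‖x‖ * ‖y‖) hε)).and self_mem_nhdsWithin).exists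
    obtain ⟨a, rfl, ha⟩ := exists_norm_lt x hδ
    obtain ⟨b, rfl, hb⟩ := exists_norm_lt y hδ
    rw [← mk_mul]
    calc _ ≤ ‖a * b‖ := norm_mk_le _
      _ ≤ ‖a‖ * ‖b‖ := norm_mul_le _ _
      _ ≤ _ := mul_le_mul ha.le hb.le (norm_nonneg _) ((norm_nonneg _).trans ha.le)
      _ < _ := hlt

lemma norm_star_le (x : J.Quot) : ‖star x‖ ≤ ‖x‖ := by
  refine le_of_forall_pos_lt_add fun ε hε => ?_
  obtain ⟨a, rfl, ha⟩ := exists_norm_lt x hε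
  rw [← mk_star]
  exact (norm_mk_le _).trans_lt (by rwa [norm_star])

instance : CStarRing J.Quot where
  norm_mul_self_le x := by
    rw [← sq]
    refine le_of_forall_pos_lt_add fun ε hε => ?_
    obtain ⟨a, rfl⟩ := mk_surjective x
    obtain ⟨b, hb, hb'⟩ := exists_norm_lt (star (mk a) * mk a : J.Quot) (half_pos hε)
    have hj : star a * a - b ∈ J := by
      rw [← mk_eq_mk, hb]; rfl
    set j := star a * a - b
    obtain ⟨e, he, hsa, hje, hle⟩ :=
      J.exists_approx j (J.mul_mem_left _ hj) (half_pos hε)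
    have h1 : (mk a : J.Quot) = mk (a - a * e) := by
      rw [mk_eq_mk, sub_sub_cancel]; exact J.mul_mem_left _ he
    have h2 : star (a - a * e) * (a - a * e)
        = star ((star (star a * a - star a * a * e)) - star (star a * a - star a * a * e) * e) := by
      simp only [star_sub, star_mul, star_star, hsa.star_eq]
      noncomm_ring
    have h3 : ‖star (a - a * e) * (a - a * e)‖ ≤ ‖star a * a - star a * a * e‖ := by
      rw [h2, norm_star]
      exact (hle _).trans_eq (norm_star _)
    have h4 : star a * a - star a * a * e = (b - b * e) + (j - j * e) := by
      simp only [j]; noncomm_ring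
    calc ‖(mk a : J.Quot)‖ ^ 2 ≤ ‖a - a * e‖ ^ 2 := by
          rw [h1]; gcongr; exact norm_mk_le _
      _ = ‖star (a - a * e) * (a - a * e)‖ := by rw [CStarRing.norm_star_mul_self, sq]
      _ ≤ ‖b - b * e‖ + ‖j - j * e‖ := h3.trans (h4 ▸ norm_add_le _ _)
      _ ≤ ‖b‖ + ε / 2 := add_le_add (hle b) hje
      _ < _ := by linarith

instance : NonUnitalCStarAlgebra J.Quot where
  smul_assoc := by rintro c ⟨a⟩ ⟨b⟩; exact congrArg mk (smul_mul_assoc c a b)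
  smul_comm := by rintro c ⟨a⟩ ⟨b⟩; exact congrArg mk (mul_smul_comm c a b).symm
  star_smul := by rintro c ⟨a⟩; exact congrArg mk (star_smul c a)

variable (J) in
/-- The quotient map `D → D / J`. -/
def mkHom : D →⋆ₙₐ[ℂ] J.Quot where
  toFun := mk
  map_smul' := mk_smul
  map_zero' := mk_zero
  map_add' := mk_add
  map_mul' := mk_mul
  map_star' := mk_star

/-- The canonical map `D / I → D / J` for `I ≤ J`. -/
def factor {I J : ClosedIdeal D} (h : I ≤ J) : I.Quot →⋆ₙₐ[ℂ] J.Quot where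
  toFun := Quotient.map id fun a b hab => by
    replace hab := (Submodule.quotientRel_def _).1 hab
    exact (Submodule.quotientRel_def _).2 (h hab)
  map_smul' c := by rintro ⟨a⟩; rfl
  map_zero' := rfl
  map_add' := by rintro ⟨a⟩ ⟨b⟩; rfl
  map_mul' := by rintro ⟨a⟩ ⟨b⟩; rfl
  map_star' := by rintro ⟨a⟩; rfl

@[simp] lemma factor_mk {I J : ClosedIdeal D} (h : I ≤ J) (x : D) :
    factor h (mk x) = mk x := rfl

end Quot

lemma le_of_eq_closure {I : ℕ → ClosedIdeal D} {J : ClosedIdeal D}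
    (hJ : (J : Set D) = closure (⋃ n, (I n : Set D))) (n : ℕ) : I n ≤ J := fun x hx => by
  have : x ∈ (J : Set D) := hJ ▸ subset_closure (Set.mem_iUnion.2 ⟨n, hx⟩)
  exact this

end ClosedIdeal

/-- A separable C*-algebra `A` is semiprojective if for every C*-algebra `D`, every increasing
sequence `I n` of closed ideals of `D` and `J` the closure of their union, each *-homomorphism
`φ : A → D / J` lifts to a *-homomorphism `ψ : A → D / I n` for some `n`. -/
def IsSemiprojective (A : Type u) [NonUnitalCStarAlgebra A] : Prop :=
  TopologicalSpace.SeparableSpace A ∧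
    ∀ (D : Type u) [NonUnitalCStarAlgebra D] (I : ℕ → ClosedIdeal D) (J : ClosedIdeal D)
      (_ : Monotone I) (hJ : (J : Set D) = closure (⋃ n, (I n : Set D))) (φ : A →⋆ₙₐ[ℂ] J.Quot),
      ∃ (n : ℕ) (ψ : A →⋆ₙₐ[ℂ] (I n).Quot),
        ∀ a, ClosedIdeal.Quot.factor (ClosedIdeal.le_of_eq_closure hJ n) (ψ a) = φ a

namespace UnivCStar

variable {A B : Type u} [CStarAlgebra A] [CStarAlgebra B]

/-- Unital *-homomorphisms `φ : A → D` and `ψ : B → D` satisfy the commutator relations `S`, a set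
of triples `(a, b, r)`, if `‖[φ a, ψ b]‖ ≤ r` for every triple `(a, b, r) ∈ S`. -/
def Satisfies (S : Set (A × B × ℝ))
    {D : Type u} [CStarAlgebra D] (φ : A →⋆ₐ[ℂ] D) (ψ : B →⋆ₐ[ℂ] D) : Prop :=
  ∀ a b r, (a, b, r) ∈ S → ‖φ a * ψ b - ψ b * φ a‖ ≤ r

variable (S : Set (A × B × ℝ))

/-- A representation of the relations `S` in a nonzero unital C*-algebra `D`. -/
structure Rep where
  D : Type u
  [str : CStarAlgebra D]
  [nontriv : Nontrivial D]
  left : A →⋆ₐ[ℂ] D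
  right : B →⋆ₐ[ℂ] D
  satisfies : Satisfies S left right

attribute [instance] Rep.str Rep.nontriv

/-- Evaluation of noncommutative polynomials in the elements of `A` and `B`. -/
def polyEval {D : Type u} [CStarAlgebra D] (φ : A →⋆ₐ[ℂ] D) (ψ : B →⋆ₐ[ℂ] D) :
    FreeAlgebra ℂ (A ⊕ B) →ₐ[ℂ] D :=
  FreeAlgebra.lift ℂ (Sum.elim φ ψ)

@[simp] lemma polyEval_inl {D : Type u} [CStarAlgebra D] (φ : A →⋆ₐ[ℂ] D) (ψ : B →⋆ₐ[ℂ] D)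
    (a : A) : polyEval φ ψ (FreeAlgebra.ι ℂ (Sum.inl a)) = φ a := by
  simp [polyEval]

@[simp] lemma polyEval_inr {D : Type u} [CStarAlgebra D] (φ : A →⋆ₐ[ℂ] D) (ψ : B →⋆ₐ[ℂ] D)
    (b : B) : polyEval φ ψ (FreeAlgebra.ι ℂ (Sum.inr b)) = ψ b := by
  simp [polyEval]

/-- The seminorm that a representation induces on noncommutative polynomials. -/
def Rep.polyNorm {S : Set (A × B × ℝ)} (ρ : Rep S) (x : FreeAlgebra ℂ (A ⊕ B)) : ℝ :=
  ‖polyEval ρ.left ρ.right x‖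

/-- The set of all seminorms induced by representations of `S`. It indexes the representations up
to isometric isomorphism of the C*-algebras that they generate. -/
abbrev Index : Type u := ↥(Set.range (Rep.polyNorm (S := S)))

/-- A chosen representation that induces the given seminorm. -/
def Index.rep {S : Set (A × B × ℝ)} (i : Index S) : Rep S := i.2.choose

lemma Index.polyNorm_rep {S : Set (A × B × ℝ)} (i : Index S) : i.rep.polyNorm = i.1 :=
  i.2.choose_spec

instance lpCStarAlgebra {I : Type u} (E : I → Type u) [∀ i, CStarAlgebra (E i)]
    [∀ i, Nontrivial (E i)] : CStarAlgebra (lp E ∞) where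

/-- The `ℓ^∞`-product of all representations of `S`. -/
abbrev Ambient : Type u := lp (fun i : Index S => i.rep.D) ∞

/-- A bounded family of unital *-homomorphisms as one into the `ℓ^∞`-product. -/
def piHom {I : Type u} (E : I → Type u) [∀ i, CStarAlgebra (E i)] [∀ i, Nontrivial (E i)]
    {C : Type u} [CStarAlgebra C] (f : ∀ i, C →⋆ₐ[ℂ] E i) : C →⋆ₐ[ℂ] lp E ∞ where
  toFun c := ⟨fun i => f i c, memℓp_infty ⟨‖c‖, by
    rintro _ ⟨i, rfl⟩
    exact NonUnitalStarAlgHom.norm_apply_le (f i) c⟩⟩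
  map_one' := by ext i; exact map_one (f i)
  map_mul' x y := by ext i; exact map_mul (f i) x y
  map_zero' := by ext i; exact map_zero (f i)
  map_add' x y := by ext i; exact map_add (f i) x y
  commutes' r := by ext i; exact AlgHomClass.commutes (f i) r
  map_star' x := by ext i; exact map_star (f i) x

/-- The diagonal map `A → ∏ D`. -/
def leftAmb : A →⋆ₐ[ℂ] Ambient S := piHom _ fun i : Index S => i.rep.left
/-- The diagonal map `B → ∏ D`. -/
def rightAmb : B →⋆ₐ[ℂ] Ambient S := piHom _ fun i : Index S => i.rep.right

/-- The C*-subalgebra of the product that the two diagonal maps generate. -/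
def subalg : StarSubalgebra ℂ (Ambient S) :=
  (StarAlgebra.adjoin ℂ (Set.range (leftAmb S) ∪ Set.range (rightAmb S))).topologicalClosure

instance : IsClosed (subalg S : Set (Ambient S)) := StarSubalgebra.isClosed_topologicalClosure _

/-- The universal unital C*-algebra generated by copies of `A` and `B` (with a common unit)
subject to the commutator relations `S`. -/
abbrev Univ : Type u := ↥(subalg S)

/-- The canonical unital *-homomorphism `A → Univ S`. -/
def inl : A →⋆ₐ[ℂ] Univ S :=
  (leftAmb S).codRestrict (subalg S) fun a => StarSubalgebra.le_topologicalClosure _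
    (StarAlgebra.subset_adjoin ℂ _ (Or.inl ⟨a, rfl⟩))

/-- The canonical unital *-homomorphism `B → Univ S`. -/
def inr : B →⋆ₐ[ℂ] Univ S :=
  (rightAmb S).codRestrict (subalg S) fun b => StarSubalgebra.le_topologicalClosure _
    (StarAlgebra.subset_adjoin ℂ _ (Or.inr ⟨b, rfl⟩))

lemma satisfies_inl_inr (hS : ∀ a b r, (a, b, r) ∈ S → 0 ≤ r) :
    Satisfies S (inl S) (inr S) := by
  intro a b r h
  refine lp.norm_le_of_forall_le (hS a b r h) fun i => ?_
  exact i.rep.satisfies a b r h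

/-- Evaluation of the universal algebra in one of the chosen representations. -/
def coord {S : Set (A × B × ℝ)} (i : Index S) : Univ S →⋆ₐ[ℂ] i.rep.D where
  toFun x := x.1 i
  map_one' := rfl
  map_mul' _ _ := rfl
  map_zero' := rfl
  map_add' _ _ := rfl
  commutes' _ := rfl
  map_star' _ := rfl

lemma coord_polyEval {S : Set (A × B × ℝ)} (i : Index S) (x : FreeAlgebra ℂ (A ⊕ B)) :
    coord i (polyEval (inl S) (inr S) x) = polyEval i.rep.left i.rep.right x := by
  have : ((coord i : Univ S →⋆ₐ[ℂ] i.rep.D) : Univ S →ₐ[ℂ] i.rep.D).comp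
      (polyEval (inl S) (inr S)) = polyEval i.rep.left i.rep.right := by
    ext x
    rcases x with a | b
    · simp; rfl
    · simp; rfl
  exact DFunLike.congr_fun this x


lemma star_polyEval
    (x : FreeAlgebra ℂ (A ⊕ B)) : ∃ y : FreeAlgebra ℂ (A ⊕ B), ∀ (E : Type u) [CStarAlgebra E] (φ' : A →⋆ₐ[ℂ] E)
      (ψ' : B →⋆ₐ[ℂ] E), star (polyEval φ' ψ' x) = polyEval φ' ψ' y := by
  induction x using FreeAlgebra.induction with
  | grade0 r =>
    exact ⟨algebraMap ℂ _ (star r), fun E _ φ' ψ' => by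
      rw [AlgHom.commutes, AlgHom.commutes, algebraMap_star_comm]⟩
  | grade1 c =>
    rcases c with a | b
    · exact ⟨FreeAlgebra.ι ℂ (Sum.inl (star a)), fun E _ φ' ψ' => by simp [map_star]⟩
    · exact ⟨FreeAlgebra.ι ℂ (Sum.inr (star b)), fun E _ φ' ψ' => by simp [map_star]⟩
  | mul p q hp hq =>
    obtain ⟨p', hp⟩ := hp
    obtain ⟨q', hq⟩ := hq
    exact ⟨q' * p', fun E _ φ' ψ' => by rw [map_mul, map_mul, star_mul, hp, hq]⟩
  | add p q hp hq =>
    obtain ⟨p', hp⟩ := hp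
    obtain ⟨q', hq⟩ := hq
    exact ⟨p' + q', fun E _ φ' ψ' => by rw [map_add, map_add, star_add, hp, hq]⟩

lemma dense_polyEval : DenseRange (polyEval (inl S) (inr S)) := by
  have hrange : ∀ y ∈ StarAlgebra.adjoin ℂ (Set.range (leftAmb S) ∪ Set.range (rightAmb S)),
      ∃ x, ((polyEval (inl S) (inr S) x : Univ S) : Ambient S) = y := by
    intro y hy
    induction hy using StarAlgebra.adjoin_induction with
    | mem y hy =>
      rcases hy with ⟨a, rfl⟩ | ⟨b, rfl⟩
      · exact ⟨FreeAlgebra.ι ℂ (Sum.inl a), by rw [polyEval_inl]; rfl⟩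
      · exact ⟨FreeAlgebra.ι ℂ (Sum.inr b), by rw [polyEval_inr]; rfl⟩
    | algebraMap r => exact ⟨algebraMap ℂ _ r, by rw [AlgHom.commutes]; rfl⟩
    | add y z _ _ h1 h2 =>
      obtain ⟨p, rfl⟩ := h1
      obtain ⟨q, rfl⟩ := h2
      exact ⟨p + q, by rw [map_add]; rfl⟩
    | mul y z _ _ h1 h2 =>
      obtain ⟨p, rfl⟩ := h1
      obtain ⟨q, rfl⟩ := h2
      exact ⟨p * q, by rw [map_mul]; rfl⟩
    | star y _ h =>
      obtain ⟨p, rfl⟩ := h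
      obtain ⟨q, hq⟩ := star_polyEval p
      exact ⟨q, by rw [← hq]; rfl⟩
  intro z
  rw [Topology.IsInducing.subtypeVal.closure_eq_preimage_closure_image]
  refine closure_mono ?_ z.2
  intro y hy
  obtain ⟨x, hx⟩ := hrange y hy
  exact ⟨_, ⟨x, rfl⟩, hx⟩

variable {S}

lemma norm_polyEval_le {D : Type u} [CStarAlgebra D] {φ : A →⋆ₐ[ℂ] D} {ψ : B →⋆ₐ[ℂ] D}
    (h : Satisfies S φ ψ) (x : FreeAlgebra ℂ (A ⊕ B)) :
    ‖polyEval φ ψ x‖ ≤ ‖polyEval (inl S) (inr S) x‖ := by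
  rcases subsingleton_or_nontrivial D with hD | hD
  · rw [Subsingleton.elim (polyEval φ ψ x) 0, norm_zero]; exact norm_nonneg _
  · let ρ : Rep S := ⟨D, φ, ψ, h⟩
    let i : Index S := ⟨ρ.polyNorm, ρ, rfl⟩
    have h1 : ‖polyEval φ ψ x‖ = ‖polyEval i.rep.left i.rep.right x‖ :=
      congrFun i.polyNorm_rep.symm x
    rw [h1, ← coord_polyEval]
    exact NonUnitalStarAlgHom.norm_apply_le (coord i) _

/-- The universal property, existence: unital *-homomorphisms `φ : A → D` and `ψ : B → D` that
satisfy the relations `S` induce a unital *-homomorphism `Univ S → D`; see `lift_inl`, `lift_inr`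
and, for uniqueness, `hom_ext`. -/
def lift {D : Type u} [CStarAlgebra D] (φ : A →⋆ₐ[ℂ] D) (ψ : B →⋆ₐ[ℂ] D)
    (h : Satisfies S φ ψ) : Univ S →⋆ₐ[ℂ] D :=
  let e := (polyEval (inl S) (inr S)).toLinearMap
  let f := (polyEval φ ψ).toLinearMap
  let F : Univ S →L[ℂ] D := f.extendOfNorm e
  have hF : ∀ x, F (polyEval (inl S) (inr S) x) = polyEval φ ψ x :=
    LinearMap.extendOfNorm_eq (f := f) (e := e) (dense_polyEval S)
      ⟨1, fun x => by rw [one_mul]; exact norm_polyEval_le h x⟩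
  { toFun := F
    map_one' := by
      have := hF 1
      rwa [map_one (polyEval (inl S) (inr S)), map_one (polyEval φ ψ)] at this
    map_mul' := fun x y => by
      refine (dense_polyEval S).induction_on₂ (p := fun x y => F (x * y) = F x * F y)
        (isClosed_eq (by fun_prop) (by fun_prop)) (fun p q => ?_) x y
      rw [← map_mul, hF, hF, hF, map_mul]
    map_zero' := map_zero F
    map_add' := map_add F
    commutes' := fun r => by
      have := hF (algebraMap ℂ _ r)
      rwa [AlgHom.commutes, AlgHom.commutes] at this
    map_star' := fun x => by
      refine (dense_polyEval S).induction_on (p := fun x => F (star x) = star (F x)) x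
        (isClosed_eq (by fun_prop) (by fun_prop)) (fun p => ?_)
      obtain ⟨q, hq⟩ := star_polyEval p
      rw [hq, hF, hF, hq] }

lemma lift_polyEval {D : Type u} [CStarAlgebra D] (φ : A →⋆ₐ[ℂ] D) (ψ : B →⋆ₐ[ℂ] D)
    (h : Satisfies S φ ψ) (x : FreeAlgebra ℂ (A ⊕ B)) :
    lift φ ψ h (polyEval (inl S) (inr S) x) = polyEval φ ψ x :=
  LinearMap.extendOfNorm_eq (f := (polyEval φ ψ).toLinearMap)
    (e := (polyEval (inl S) (inr S)).toLinearMap) (dense_polyEval S)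
      ⟨1, fun x => by rw [one_mul]; exact norm_polyEval_le h x⟩ x

lemma lift_inl {D : Type u} [CStarAlgebra D] (φ : A →⋆ₐ[ℂ] D) (ψ : B →⋆ₐ[ℂ] D)
    (h : Satisfies S φ ψ) (a : A) : lift φ ψ h (inl S a) = φ a := by
  simpa using lift_polyEval φ ψ h (FreeAlgebra.ι ℂ (Sum.inl a))

lemma lift_inr {D : Type u} [CStarAlgebra D] (φ : A →⋆ₐ[ℂ] D) (ψ : B →⋆ₐ[ℂ] D)
    (h : Satisfies S φ ψ) (b : B) : lift φ ψ h (inr S b) = ψ b := by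
  simpa using lift_polyEval φ ψ h (FreeAlgebra.ι ℂ (Sum.inr b))

/-- The universal property, uniqueness: `Univ S` is generated by the copies of `A` and `B`. -/
lemma hom_ext {D : Type u} [CStarAlgebra D] {f g : Univ S →⋆ₐ[ℂ] D}
    (hl : ∀ a, f (inl S a) = g (inl S a)) (hr : ∀ b, f (inr S b) = g (inr S b)) : f = g := by
  have key : (f : Univ S →ₐ[ℂ] D).comp (polyEval (inl S) (inr S))
      = (g : Univ S →ₐ[ℂ] D).comp (polyEval (inl S) (inr S)) := by
    ext x
    rcases x with a | b
    · simpa using hl a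
    · simpa using hr b
  ext x
  have hf : Continuous f := AddMonoidHomClass.continuous_of_bound f 1 fun x => by
    rw [one_mul]; exact NonUnitalStarAlgHom.norm_apply_le f x
  have hg : Continuous g := AddMonoidHomClass.continuous_of_bound g 1 fun x => by
    rw [one_mul]; exact NonUnitalStarAlgHom.norm_apply_le g x
  exact (dense_polyEval S).induction_on (p := fun x => f x = g x) x (isClosed_eq hf hg)
    fun p => DFunLike.congr_fun key p

end UnivCStar

section SoftTensor

variable {A B : Type u} [CStarAlgebra A] [CStarAlgebra B]

/-- `G` is a set of generators of the unital C*-algebra `A`, and it is finite or the set of terms of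
a sequence that converges to `0`. -/
def IsGeneratingSet (G : Set A) : Prop :=
  (G.Finite ∨ ∃ s : ℕ → A, Set.range s = G ∧ Filter.Tendsto s Filter.atTop (𝓝 0)) ∧
    (StarAlgebra.adjoin ℂ G).topologicalClosure = ⊤

/-- The relations `[a, b] = 0` for all `a ∈ A` and `b ∈ B`. -/
def commRelations (A B : Type u) [CStarAlgebra A] [CStarAlgebra B] : Set (A × B × ℝ) :=
  {t | t.2.2 = 0}

/-- The maximal tensor product `A ⊗ B`: the universal unital C*-algebra generated by commuting
copies of `A` and `B` with a common unit. -/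
abbrev MaxTensor (A B : Type u) [CStarAlgebra A] [CStarAlgebra B] : Type u :=
  UnivCStar.Univ (commRelations A B)

/-- The relations `‖[a, b]‖ ≤ ε` for `a` in `G` or the adjoint of an element of `G`, and `b` in `H`
or the adjoint of an element of `H`. -/
def softRelations (G : Set A) (H : Set B) (ε : ℝ) : Set (A × B × ℝ) :=
  {t | (t.1 ∈ G ∨ star t.1 ∈ G) ∧ (t.2.1 ∈ H ∨ star t.2.1 ∈ H) ∧ t.2.2 = ε}

/-- The soft tensor product: the universal unital C*-algebra generated by unital copies of `A` and
`B` in which the generators in `G` and their adjoints `ε`-commute with the generators in `H` and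
their adjoints. -/
abbrev SoftTensor (G : Set A) (H : Set B) (ε : ℝ) : Type u :=
  UnivCStar.Univ (softRelations G H ε)

lemma satisfies_softRelations (G : Set A) (H : Set B) {ε : ℝ} (hε : 0 < ε) :
    UnivCStar.Satisfies (softRelations G H ε)
      (UnivCStar.inl (commRelations A B)) (UnivCStar.inr (commRelations A B)) := by
  rintro a b r ⟨-, -, hr⟩
  obtain rfl : r = ε := hr
  exact (UnivCStar.satisfies_inl_inr (commRelations A B)
    (fun _ _ r (h : r = 0) => h.ge) a b 0 rfl).trans hε.le

/-- The natural quotient map from the soft tensor product to `A ⊗ B`; it takes the copies of `A` and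
`B` in the former to those in the latter. -/
def softQuotientMap (G : Set A) (H : Set B) {ε : ℝ} (hε : 0 < ε) :
    SoftTensor G H ε →⋆ₐ[ℂ] MaxTensor A B :=
  UnivCStar.lift (UnivCStar.inl (commRelations A B)) (UnivCStar.inr (commRelations A B))
    (satisfies_softRelations G H hε)

/-- The quotient map from the soft tensor product to `A ⊗ B` has a right inverse that is a unital
*-homomorphism. -/
def SplitsUnitally (G : Set A) (H : Set B) {ε : ℝ} (hε : 0 < ε) : Prop :=
  ∃ σ : MaxTensor A B →⋆ₐ[ℂ] SoftTensor G H ε, ∀ x, softQuotientMap G H hε (σ x) = x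

end SoftTensor

end

/-! ### Homomorphisms, kernels and quotients of C*-algebras. -/

noncomputable section

/-! As the tolerance shrinks to `0`, the soft tensor products approach `A ⊗ B`: in `SoftTensor G H
1` the kernels of the maps to tolerance `1 / (n + 1)` increase, and modulo the closure `J` of their
union the generators commute exactly. So `A ⊗ B` maps to the quotient by `J`. If `A ⊗ B` is
semiprojective, this map lifts to a finite stage, which embeds in a soft tensor product, and the
lift is a splitting (`exists_splitsUnitally`). A splitting at one tolerance gives one at each
smaller tolerance, by composing with the canonical map between soft tensor products.

Conversely, let `π_ε` split and let `φ` map `A ⊗ B` to `D / J`. Semiprojectivity lifts the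
restrictions of `φ` to `A` and `B` separately. The lifts commute modulo `J`, so their commutators
become small far out in the sequence of ideals, uniformly on the generators by compactness. At such
a stage they define a map on the soft tensor product, and its composite with the splitting lifts `φ`
(`SplitsUnitally.hasUnitalLifting`).

Both arguments are unital, while semiprojectivity allows any C*-algebra and any *-homomorphism.
`IsSemiprojective.hasUnitalLifting` and `HasUnitalLifting.isSemiprojective` translate; the latter
lifts `φ 1` to a projection and works in the corner it cuts out. -/

lemma starHom_continuous {A B : Type*} [NonUnitalCStarAlgebra A] [NonUnitalCStarAlgebra B]
    (f : A →⋆ₙₐ[ℂ] B) : Continuous f :=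
  AddMonoidHomClass.continuous_of_bound f 1 fun x => by
    rw [one_mul]; exact NonUnitalStarAlgHom.norm_apply_le f x

/-- A *-homomorphism between unital C*-algebras that preserves the unit, as a unital one. -/
def StarAlgHom.ofMapOne {A B : Type*} [CStarAlgebra A] [CStarAlgebra B] (f : A →⋆ₙₐ[ℂ] B)
    (h : f 1 = 1) : A →⋆ₐ[ℂ] B where
  toFun := f
  map_one' := h
  map_mul' := map_mul f
  map_zero' := map_zero f
  map_add' := map_add f
  commutes' r := by rw [Algebra.algebraMap_eq_smul_one, map_smul, h, Algebra.algebraMap_eq_smul_one]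
  map_star' := map_star f

@[simp] lemma StarAlgHom.ofMapOne_apply {A B : Type*} [CStarAlgebra A] [CStarAlgebra B]
    (f : A →⋆ₙₐ[ℂ] B) (h : f 1 = 1) (x : A) : StarAlgHom.ofMapOne f h x = f x := rfl

/-- A *-homomorphism whose range lies in that of an injective one factors through it. -/
lemma exists_starHom_of_injective {X Y Z : Type*} [NonUnitalCStarAlgebra X]
    [NonUnitalCStarAlgebra Y] [NonUnitalCStarAlgebra Z] (i : Y →⋆ₙₐ[ℂ] Z)
    (hi : Function.Injective i) (g : X →⋆ₙₐ[ℂ] Z) (h : ∀ x, ∃ y, i y = g x) :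
    ∃ k : X →⋆ₙₐ[ℂ] Y, ∀ x, i (k x) = g x := by
  choose k hk using h
  exact ⟨{
    toFun := k
    map_smul' := fun c x => hi (by simp [hk])
    map_zero' := hi (by simp [hk])
    map_add' := fun x y => hi (by simp [hk])
    map_mul' := fun x y => hi (by simp [hk])
    map_star' := fun x => hi (by simp [hk, map_star]) }, hk⟩

/-- A self-adjoint idempotent of norm less than one vanishes. -/
lemma eq_zero_of_isIdempotentElem_of_norm_lt_one {A : Type*} [NonUnitalCStarAlgebra A] {e : A}
    (h : e * e = e) (hn : ‖e‖ < 1) : e = 0 := by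
  have h1 : ‖e‖ ≤ ‖e‖ * ‖e‖ := by
    conv_lhs => rw [← h]
    exact norm_mul_le e e
  rw [← norm_eq_zero]
  nlinarith [norm_nonneg e]

namespace ClosedIdeal

/-- The kernel of a *-homomorphism. -/
def ker {D E : Type u} [NonUnitalCStarAlgebra D] [NonUnitalCStarAlgebra E] (f : D →⋆ₙₐ[ℂ] E) :
    ClosedIdeal D where
  carrier := {x | f x = 0}
  add_mem' {x y} hx hy := by
    change f (x + y) = 0
    rw [map_add, show f x = 0 from hx, show f y = 0 from hy, add_zero]
  zero_mem' := map_zero f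
  smul_mem' c x hx := by
    change f (c • x) = 0
    rw [map_smul, show f x = 0 from hx, smul_zero]
  mul_mem_left' x y hy := by
    change f (x * y) = 0
    rw [map_mul, show f y = 0 from hy, mul_zero]
  mul_mem_right' x y hx := by
    change f (x * y) = 0
    rw [map_mul, show f x = 0 from hx, zero_mul]
  isClosed' := isClosed_eq (starHom_continuous f) continuous_const

/-- The closure of the union of an increasing sequence of closed ideals. -/
def closureUnion {D : Type u} [NonUnitalCStarAlgebra D] (I : ℕ → ClosedIdeal D) (hI : Monotone I) :
    ClosedIdeal D where
  toSubmodule := (⨆ n, (I n).toSubmodule).topologicalClosure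
  mul_mem_left' x y hy := by
    have hd : Directed (· ≤ ·) fun n => (I n).toSubmodule :=
      directed_of_isDirected_le fun m n h => hI h
    refine map_mem_closure (f := fun y => x * y) (by fun_prop) hy fun z hz => ?_
    obtain ⟨n, hn⟩ := (Submodule.mem_iSup_of_directed _ hd).1 hz
    exact (Submodule.mem_iSup_of_directed _ hd).2 ⟨n, (I n).mul_mem_left x hn⟩
  mul_mem_right' x y hx := by
    have hd : Directed (· ≤ ·) fun n => (I n).toSubmodule :=
      directed_of_isDirected_le fun m n h => hI h
    refine map_mem_closure (f := fun x => x * y) (by fun_prop) hx fun z hz => ?_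
    obtain ⟨n, hn⟩ := (Submodule.mem_iSup_of_directed _ hd).1 hz
    exact (Submodule.mem_iSup_of_directed _ hd).2 ⟨n, (I n).mul_mem_right y hn⟩
  isClosed' := Submodule.isClosed_topologicalClosure _

lemma coe_closureUnion {D : Type u} [NonUnitalCStarAlgebra D] (I : ℕ → ClosedIdeal D)
    (hI : Monotone I) : (closureUnion I hI : Set D) = closure (⋃ n, (I n : Set D)) := by
  have hd : Directed (· ≤ ·) fun n => (I n).toSubmodule :=
    directed_of_isDirected_le fun m n h => hI h
  change closure ((⨆ n, (I n).toSubmodule : Submodule ℂ D) : Set D) = _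
  rw [Submodule.coe_iSup_of_directed _ hd]
  rfl

/-- Elements of the closure of the union of an increasing sequence of ideals have small image in
the quotients by ideals far out in the sequence. -/
lemma exists_norm_mk_lt {D : Type u} [NonUnitalCStarAlgebra D] {I : ℕ → ClosedIdeal D}
    (hI : Monotone I) {J : ClosedIdeal D} (hJ : (J : Set D) = closure (⋃ n, (I n : Set D)))
    {x : D} (hx : x ∈ J) {ε : ℝ} (hε : 0 < ε) :
    ∃ n₀, ∀ n, n₀ ≤ n → ‖(Quot.mk x : (I n).Quot)‖ < ε := by
  have hx' : x ∈ closure (⋃ n, (I n : Set D)) := hJ ▸ hx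
  obtain ⟨y, hy, hxy⟩ := Metric.mem_closure_iff.1 hx' ε hε
  obtain ⟨n₀, hn₀⟩ := Set.mem_iUnion.1 hy
  refine ⟨n₀, fun n hn => ?_⟩
  have hyn : y ∈ I n := hI hn hn₀
  have : (Quot.mk x : (I n).Quot) = Quot.mk (x - y) := by
    rw [Quot.mk_eq_mk, sub_sub_cancel]; exact hyn
  rw [this]
  exact (Quot.norm_mk_le _).trans_lt (by rwa [← dist_eq_norm])

namespace Quot

/-- The *-homomorphism on a quotient induced by one that vanishes on the ideal. -/
def liftHom {D E : Type u} [NonUnitalCStarAlgebra D] [NonUnitalCStarAlgebra E] (J : ClosedIdeal D)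
    (f : D →⋆ₙₐ[ℂ] E) (h : ∀ x ∈ J, f x = 0) : J.Quot →⋆ₙₐ[ℂ] E where
  toFun := Quotient.lift f fun a b hab => by
    replace hab := (Submodule.quotientRel_def _).1 hab
    rw [← sub_eq_zero, ← map_sub]
    exact h _ hab
  map_smul' c := by rintro ⟨a⟩; exact map_smul f c a
  map_zero' := map_zero f
  map_add' := by rintro ⟨a⟩ ⟨b⟩; exact map_add f a b
  map_mul' := by rintro ⟨a⟩ ⟨b⟩; exact map_mul f a b
  map_star' := by rintro ⟨a⟩; exact map_star f a

@[simp] lemma liftHom_mk {D E : Type u} [NonUnitalCStarAlgebra D] [NonUnitalCStarAlgebra E]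
    (J : ClosedIdeal D) (f : D →⋆ₙₐ[ℂ] E) (h : ∀ x ∈ J, f x = 0) (x : D) :
    liftHom J f h (mk x) = f x := rfl

/-- An injective *-homomorphism is isometric, so norms modulo a kernel can be computed in the
target. -/
lemma liftHom_ker_injective {D E : Type u} [NonUnitalCStarAlgebra D] [NonUnitalCStarAlgebra E]
    (f : D →⋆ₙₐ[ℂ] E) : Function.Injective (liftHom (ker f) f fun _ h => h) := by
  rw [injective_iff_map_eq_zero]
  intro x hx
  obtain ⟨d, rfl⟩ := mk_surjective x
  rw [← mk_zero, mk_eq_mk, sub_zero]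
  exact hx

lemma factor_factor {D : Type u} [NonUnitalCStarAlgebra D] {I J K : ClosedIdeal D} (h : I ≤ J)
    (h' : J ≤ K) (x : I.Quot) : factor h' (factor h x) = factor (h.trans h') x := by
  obtain ⟨d, rfl⟩ := mk_surjective x
  rfl

section Unital

variable {E : Type u} [CStarAlgebra E]

/-- The unital instances extend the non-unital ones already on the quotient, so `mkHom` and `factor`
apply to them unchanged. -/
instance instOneQuot (J : ClosedIdeal E) : One J.Quot := ⟨mk 1⟩

instance instRingQuot (J : ClosedIdeal E) : Ring J.Quot where
  __ := (inferInstance : NonUnitalRing J.Quot)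
  one_mul := by rintro ⟨a⟩; exact congrArg mk (one_mul a)
  mul_one := by rintro ⟨a⟩; exact congrArg mk (mul_one a)

instance instNormedRingQuot (J : ClosedIdeal E) : NormedRing J.Quot where
  __ := (inferInstance : NonUnitalNormedRing J.Quot)
  __ := (inferInstance : Ring J.Quot)

instance instNormedAlgebraQuot (J : ClosedIdeal E) : NormedAlgebra ℂ J.Quot where
  __ := (inferInstance : NormedSpace ℂ J.Quot)
  __ := Algebra.ofModule (R := ℂ) (A := J.Quot)
    (by rintro c ⟨a⟩ ⟨b⟩; exact congrArg mk (smul_mul_assoc c a b))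
    (by rintro c ⟨a⟩ ⟨b⟩; exact congrArg mk (mul_smul_comm c a b))

instance instCStarAlgebraQuot (J : ClosedIdeal E) : CStarAlgebra J.Quot where
  __ := (inferInstance : NonUnitalCStarAlgebra J.Quot)
  __ := (inferInstance : NormedRing J.Quot)
  __ := (inferInstance : NormedAlgebra ℂ J.Quot)

lemma factor_one {I J : ClosedIdeal E} (h : I ≤ J) : factor h (1 : I.Quot) = 1 := rfl

/-- The quotient map of a unital C*-algebra. -/
def mkUnital (J : ClosedIdeal E) : E →⋆ₐ[ℂ] J.Quot := StarAlgHom.ofMapOne (mkHom J) rfl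

/-- The canonical map between quotients of a unital C*-algebra. -/
def factorUnital {I J : ClosedIdeal E} (h : I ≤ J) : I.Quot →⋆ₐ[ℂ] J.Quot :=
  StarAlgHom.ofMapOne (factor h) rfl

end Unital

end Quot

end ClosedIdeal

/-! ### The unital lifting property. -/

open ClosedIdeal

/-- The lifting property of semiprojectivity for unital C*-algebras and unital homomorphisms. -/
def HasUnitalLifting (T : Type u) [CStarAlgebra T] : Prop :=
  ∀ (E : Type u) [CStarAlgebra E] (I : ℕ → ClosedIdeal E) (J : ClosedIdeal E)
    (_ : Monotone I) (hJ : (J : Set E) = closure (⋃ n, (I n : Set E))) (φ : T →⋆ₐ[ℂ] J.Quot),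
    ∃ (n : ℕ) (ψ : T →⋆ₐ[ℂ] (I n).Quot),
      ∀ t, ClosedIdeal.Quot.factor (le_of_eq_closure hJ n) (ψ t) = φ t

/-- A lift `ψ` of a unital map may fail to be unital, but its defect `1 - ψ 1` is an idempotent that
dies in the limit. Its norm drops below one at some later stage, where it must vanish. -/
lemma IsSemiprojective.hasUnitalLifting {T : Type u} [CStarAlgebra T] (h : IsSemiprojective T) :
    HasUnitalLifting T := by
  intro E _ I J hI hJ φ
  obtain ⟨n, ψ, hψ⟩ := h.2 E I J hI hJ (φ : T →⋆ₙₐ[ℂ] J.Quot)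
  obtain ⟨x, hx⟩ := ClosedIdeal.Quot.mk_surjective (1 - ψ 1)
  have hxJ : x ∈ J := by
    have : (ClosedIdeal.Quot.mk x : J.Quot) = 0 := by
      rw [← ClosedIdeal.Quot.factor_mk (le_of_eq_closure hJ n), hx, map_sub, hψ,
        ClosedIdeal.Quot.factor_one]
      simp
    rwa [← ClosedIdeal.Quot.mk_zero, ClosedIdeal.Quot.mk_eq_mk, sub_zero] at this
  obtain ⟨m, hm⟩ := exists_norm_mk_lt hI hJ hxJ one_pos
  have hnk : I n ≤ I (max n m) := hI (le_max_left n m)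
  have hx' : (ClosedIdeal.Quot.mk x : (I (max n m)).Quot)
      = 1 - ClosedIdeal.Quot.factor hnk (ψ 1) := by
    rw [← ClosedIdeal.Quot.factor_mk hnk, hx, map_sub, ClosedIdeal.Quot.factor_one]
  have h0 : (ClosedIdeal.Quot.mk x : (I (max n m)).Quot) = 0 := by
    refine eq_zero_of_isIdempotentElem_of_norm_lt_one ?_ (hm _ (le_max_right n m))
    have h1 : ClosedIdeal.Quot.factor hnk (ψ 1) * ClosedIdeal.Quot.factor hnk (ψ 1)
        = ClosedIdeal.Quot.factor hnk (ψ 1) := by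
      rw [← map_mul, ← map_mul, one_mul]
    rw [hx', mul_sub, sub_mul, sub_mul, h1]
    simp
  refine ⟨max n m, StarAlgHom.ofMapOne ((ClosedIdeal.Quot.factor hnk).comp ψ) ?_, fun t => ?_⟩
  · rw [hx', sub_eq_zero] at h0
    exact h0.symm
  · change ClosedIdeal.Quot.factor _ (ClosedIdeal.Quot.factor hnk (ψ t)) = _
    rw [ClosedIdeal.Quot.factor_factor, hψ]
    rfl

end

/-! ### Corners, and semiprojectivity from unital lifting. -/

noncomputable section

/-- The corner `q D q` of a projection `q`, given by the elements on which `q` acts as a unit. -/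
def corner {D : Type u} [NonUnitalCStarAlgebra D] (q : {q : D // IsStarProjection q}) :
    NonUnitalStarSubalgebra ℂ D where
  carrier := {x | q.1 * x = x ∧ x * q.1 = x}
  add_mem' {x y} hx hy := ⟨by rw [mul_add, hx.1, hy.1], by rw [add_mul, hx.2, hy.2]⟩
  zero_mem' := ⟨mul_zero _, zero_mul _⟩
  mul_mem' {x y} hx hy := ⟨by rw [← mul_assoc, hx.1], by rw [mul_assoc, hy.2]⟩
  smul_mem' c x hx := ⟨by rw [mul_smul_comm, hx.1], by rw [smul_mul_assoc, hx.2]⟩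
  star_mem' {x} hx := by
    have hq : star q.1 = q.1 := q.2.isSelfAdjoint
    exact ⟨by conv_rhs => rw [← hx.2, star_mul, hq], by conv_rhs => rw [← hx.1, star_mul, hq]⟩

namespace corner

variable {D : Type u} [NonUnitalCStarAlgebra D] (q : {q : D // IsStarProjection q})

instance isClosed : IsClosed (corner q : Set D) :=
  (isClosed_eq (f := fun x => q.1 * x) (by fun_prop) continuous_id).inter
    (isClosed_eq (f := fun x => x * q.1) (by fun_prop) continuous_id)

/-- The projection is the unit of its corner. Its proof is bundled into `q` so that the unital
structure is available to instance search. -/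
instance instOne : One (corner q) :=
  ⟨⟨q.1, q.2.isIdempotentElem, q.2.isIdempotentElem⟩⟩

instance instRing : Ring (corner q) where
  __ := (inferInstance : NonUnitalRing (corner q))
  one_mul x := Subtype.ext x.2.1
  mul_one x := Subtype.ext x.2.2

instance instNormedRing : NormedRing (corner q) where
  __ := (inferInstance : NonUnitalNormedRing (corner q))
  __ := (inferInstance : Ring (corner q))

instance instNormedAlgebra : NormedAlgebra ℂ (corner q) where
  __ := (inferInstance : NormedSpace ℂ (corner q))
  __ := Algebra.ofModule (R := ℂ) (A := corner q)
    (fun c x y => smul_mul_assoc c x y) (fun c x y => mul_smul_comm c x y)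

instance instCStarAlgebra : CStarAlgebra (corner q) where
  __ := (inferInstance : NonUnitalCStarAlgebra (corner q))
  __ := (inferInstance : NormedRing (corner q))
  __ := (inferInstance : NormedAlgebra ℂ (corner q))

lemma compress_mem (x : D) : q.1 * x * q.1 ∈ corner q := by
  have h : q.1 * q.1 = q.1 := q.2.isIdempotentElem
  refine ⟨?_, ?_⟩
  · rw [← mul_assoc, ← mul_assoc, h]
  · rw [mul_assoc, h]

/-- The inclusion of a corner. -/
def incl : corner q →⋆ₙₐ[ℂ] D := NonUnitalStarSubalgebraClass.subtype (corner q)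

lemma norm_compress_le (x : D) : ‖q.1 * x * q.1‖ ≤ ‖x‖ := by
  have hq : ‖q.1‖ ≤ 1 := by
    have h : ‖star q.1 * q.1‖ = ‖q.1‖ * ‖q.1‖ := CStarRing.norm_star_mul_self
    have hs : star q.1 = q.1 := q.2.isSelfAdjoint
    have hi : q.1 * q.1 = q.1 := q.2.isIdempotentElem
    rw [hs, hi] at h
    nlinarith [norm_nonneg q.1]
  calc _ ≤ ‖q.1‖ * ‖x‖ * ‖q.1‖ := (norm_mul_le _ _).trans (by gcongr; exact norm_mul_le _ _)
    _ ≤ 1 * ‖x‖ * 1 := by gcongr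
    _ = ‖x‖ := by ring

end corner

/-- The unital lifting property implies semiprojectivity if the image of the unit can be lifted to a
projection. -/
lemma HasUnitalLifting.isSemiprojective {T : Type u} [CStarAlgebra T]
    (hsep : TopologicalSpace.SeparableSpace T) (hT : HasUnitalLifting T)
    (hproj : ∀ (D : Type u) [NonUnitalCStarAlgebra D] (I : ℕ → ClosedIdeal D) (J : ClosedIdeal D)
      (_ : Monotone I) (hJ : (J : Set D) = closure (⋃ n, (I n : Set D))) (φ : T →⋆ₙₐ[ℂ] J.Quot),
      ∃ (n : ℕ) (q : (I n).Quot), IsStarProjection q ∧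
        ClosedIdeal.Quot.factor (ClosedIdeal.le_of_eq_closure hJ n) q = φ 1) :
    IsSemiprojective T := by
  refine ⟨hsep, fun D _ I J hI hJ φ => ?_⟩
  obtain ⟨n, q₀, hq₀, hqφ⟩ := hproj D I J hI hJ φ
  let q : {q : (I n).Quot // IsStarProjection q} := ⟨q₀, hq₀⟩
  have hle : ∀ m, I n ≤ I (n + m) := fun m => hI (Nat.le_add_right n m)
  have hleJ : ∀ m, I m ≤ J := ClosedIdeal.le_of_eq_closure hJ
  -- The lifting problem is moved to the corner of `q` in `D / I n`, with the kernels of the maps `f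
  -- m` as the increasing ideals.
  let f : ∀ m, corner q →⋆ₙₐ[ℂ] (I (n + m)).Quot := fun m =>
    (ClosedIdeal.Quot.factor (hle m)).comp (corner.incl q)
  let g : corner q →⋆ₙₐ[ℂ] J.Quot := (ClosedIdeal.Quot.factor (hleJ n)).comp (corner.incl q)
  have hfg : ∀ m x, ClosedIdeal.Quot.factor (hleJ (n + m)) (f m x) = g x := fun m x =>
    ClosedIdeal.Quot.factor_factor (hle m) (hleJ (n + m)) _
  let I' : ℕ → ClosedIdeal (corner q) := fun m => ClosedIdeal.ker (f m)
  have hI' : Monotone I' := by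
    intro m k hmk x hx
    have hx' : f m x = 0 := hx
    have : f k x = ClosedIdeal.Quot.factor (hI (Nat.add_le_add_left hmk n)) (f m x) :=
      (ClosedIdeal.Quot.factor_factor (hle m) (hI (Nat.add_le_add_left hmk n)) _).symm
    change f k x = 0
    rw [this, hx', map_zero]
  have hJ' : (ClosedIdeal.ker g : Set (corner q)) = closure (⋃ m, (I' m : Set (corner q))) := by
    apply Set.Subset.antisymm
    · intro x hx
      obtain ⟨d, hd⟩ := ClosedIdeal.Quot.mk_surjective (x : (I n).Quot)
      have hdJ : d ∈ J := by
        have h0 : ClosedIdeal.Quot.factor (hleJ n) (x : (I n).Quot) = 0 := hx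
        rw [← hd, ClosedIdeal.Quot.factor_mk, ← ClosedIdeal.Quot.mk_zero,
          ClosedIdeal.Quot.mk_eq_mk, sub_zero] at h0
        exact h0
      refine Metric.mem_closure_iff.2 fun ε hε => ?_
      have hd' : d ∈ closure (⋃ n, (I n : Set D)) := hJ ▸ hdJ
      obtain ⟨y, hy, hdy⟩ := Metric.mem_closure_iff.1 hd' ε hε
      obtain ⟨m, hm⟩ := Set.mem_iUnion.1 hy
      -- Compression by `q` is contractive and fixes `x`, so an approximant `y` of `d` in `I m`
      -- compresses to an approximant of `x` in the corner.
      refine ⟨⟨_, corner.compress_mem q (ClosedIdeal.Quot.mk y)⟩, Set.mem_iUnion.2 ⟨m, ?_⟩, ?_⟩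
      · change ClosedIdeal.Quot.factor (hle m) (q.1 * ClosedIdeal.Quot.mk y * q.1) = 0
        have : (ClosedIdeal.Quot.mk y : (I (n + m)).Quot) = 0 := by
          rw [← ClosedIdeal.Quot.mk_zero, ClosedIdeal.Quot.mk_eq_mk, sub_zero]
          exact hI (Nat.le_add_left m n) hm
        rw [map_mul, map_mul, ClosedIdeal.Quot.factor_mk, this, mul_zero, zero_mul]
      · have hx1 : (x : (I n).Quot) = q.1 * ClosedIdeal.Quot.mk d * q.1 := by
          rw [hd, x.2.1, x.2.2]
        rw [Subtype.dist_eq, dist_eq_norm, hx1, ← sub_mul, ← mul_sub, ← ClosedIdeal.Quot.mk_sub]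
        refine (corner.norm_compress_le q _).trans_lt ((ClosedIdeal.Quot.norm_mk_le _).trans_lt ?_)
        rwa [← dist_eq_norm]
    · refine closure_minimal (Set.iUnion_subset fun m x hx => ?_) (ClosedIdeal.isClosed _)
      change g x = 0
      rw [← hfg m, show f m x = 0 from hx, map_zero]
  let i : (ClosedIdeal.ker g).Quot →⋆ₙₐ[ℂ] J.Quot := ClosedIdeal.Quot.liftHom _ g fun _ h => h
  have hi : Function.Injective i := ClosedIdeal.Quot.liftHom_ker_injective g
  -- Since `φ t = φ 1 * φ t * φ 1` and `q` lifts `φ 1`, the range of `φ` lies in the image of the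
  -- corner; there `φ` becomes unital.
  have hφi : ∀ t, ∃ y, i y = φ t := by
    intro t
    obtain ⟨d, hd⟩ := ClosedIdeal.Quot.mk_surjective (φ t)
    refine ⟨ClosedIdeal.Quot.mk ⟨_, corner.compress_mem q (ClosedIdeal.Quot.mk d)⟩, ?_⟩
    change ClosedIdeal.Quot.factor (hleJ n) (q₀ * ClosedIdeal.Quot.mk d * q₀) = _
    rw [map_mul, map_mul, hqφ, ClosedIdeal.Quot.factor_mk, hd, ← map_mul, ← map_mul, one_mul,
      mul_one]
  obtain ⟨φ', hφ'⟩ := exists_starHom_of_injective i hi φ hφi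
  have hφ1 : φ' 1 = 1 := hi (by rw [hφ', ← hqφ]; rfl)
  obtain ⟨m, ψ, hψ⟩ := hT (corner q) I' (ClosedIdeal.ker g) hI' hJ' (StarAlgHom.ofMapOne φ' hφ1)
  -- The lift found in the quotient of the corner is carried back to the quotient of `D`.
  let j : (I' m).Quot →⋆ₙₐ[ℂ] (I (n + m)).Quot :=
    ClosedIdeal.Quot.liftHom _ (f m) fun _ h => h
  have hij : ∀ y, ClosedIdeal.Quot.factor (hleJ (n + m)) (j y)
      = i (ClosedIdeal.Quot.factor (ClosedIdeal.le_of_eq_closure hJ' m) y) := by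
    intro y
    obtain ⟨x, rfl⟩ := ClosedIdeal.Quot.mk_surjective y
    exact hfg m x
  refine ⟨n + m, j.comp ψ.toNonUnitalStarAlgHom, fun t => ?_⟩
  change ClosedIdeal.Quot.factor (hleJ (n + m)) (j (ψ t)) = φ t
  rw [hij, hψ, StarAlgHom.ofMapOne_apply, hφ']

end

/-! ### Commutation on generators, separability, and maps between soft tensor products. -/

noncomputable section

/-- An element that commutes with generators and their adjoints commutes with the whole algebra. -/
lemma commute_of_generates {A D : Type*} [CStarAlgebra A] [CStarAlgebra D] (φ : A →⋆ₐ[ℂ] D)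
    {G : Set A} (hG : (StarAlgebra.adjoin ℂ G).topologicalClosure = ⊤) {d : D}
    (h : ∀ a, (a ∈ G ∨ star a ∈ G) → Commute (φ a) d) (a : A) : Commute (φ a) d := by
  have hφ : Continuous φ := starHom_continuous (φ : A →⋆ₙₐ[ℂ] D)
  -- As `d` need not be self-adjoint, commuting with `φ x` does not give commuting with its adjoint;
  -- the induction carries both.
  have key : ∀ x ∈ StarAlgebra.adjoin ℂ G, Commute (φ x) d ∧ Commute (φ (star x)) d := by
    intro x hx
    induction hx using StarAlgebra.adjoin_induction with
    | mem x hx => exact ⟨h x (Or.inl hx), h _ (Or.inr (by rwa [star_star]))⟩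
    | algebraMap r =>
      rw [← algebraMap_star_comm, AlgHomClass.commutes, AlgHomClass.commutes]
      exact ⟨Algebra.commutes _ _, Algebra.commutes _ _⟩
    | add x y _ _ hx hy =>
      rw [star_add, map_add, map_add]
      exact ⟨hx.1.add_left hy.1, hx.2.add_left hy.2⟩
    | mul x y _ _ hx hy =>
      rw [star_mul, map_mul, map_mul]
      exact ⟨hx.1.mul_left hy.1, hy.2.mul_left hx.2⟩
    | star x _ hx => exact ⟨hx.2, by rw [star_star]; exact hx.1⟩
  have ha : a ∈ closure (StarAlgebra.adjoin ℂ G : Set A) := by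
    have : a ∈ (StarAlgebra.adjoin ℂ G).topologicalClosure := hG ▸ trivial
    exact this
  exact closure_minimal (t := {x | φ x * d = d * φ x}) (fun x hx => (key x hx).1)
    (isClosed_eq (by fun_prop) (by fun_prop)) ha

/-- Homomorphisms that commute on generators and their adjoints commute. -/
lemma commute_of_generates₂ {A B D : Type*} [CStarAlgebra A] [CStarAlgebra B] [CStarAlgebra D]
    (φ : A →⋆ₐ[ℂ] D) (ψ : B →⋆ₐ[ℂ] D) {G : Set A} {H : Set B}
    (hG : (StarAlgebra.adjoin ℂ G).topologicalClosure = ⊤)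
    (hH : (StarAlgebra.adjoin ℂ H).topologicalClosure = ⊤)
    (h : ∀ a b, (a ∈ G ∨ star a ∈ G) → (b ∈ H ∨ star b ∈ H) → Commute (φ a) (ψ b)) (a : A)
    (b : B) : Commute (φ a) (ψ b) :=
  commute_of_generates φ hG (fun a ha =>
    (commute_of_generates ψ hH (fun b hb => (h a b ha hb).symm) b).symm) a

/-- Words in a countable set are countable, and by continuity of multiplication the closure of the
submonoid they form is again a submonoid. -/
lemma Submonoid.isSeparable_closure {M : Type*} [Monoid M] [TopologicalSpace M] [ContinuousMul M]
    {s : Set M} (hs : TopologicalSpace.IsSeparable s) :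
    TopologicalSpace.IsSeparable (Submonoid.closure s : Set M) := by
  obtain ⟨c, hc, hsc⟩ := hs
  refine ⟨Submonoid.closure c, ?_, ?_⟩
  · have : Countable c := hc
    rw [Submonoid.closure_eq_image_prod]
    refine Set.Countable.image ?_ _
    have : {l : List M | ∀ x ∈ l, x ∈ c} ⊆ Set.range (List.map ((↑) : c → M)) := by
      intro l hl
      lift l to List c using hl
      exact ⟨l, rfl⟩
    exact (Set.countable_range _).mono this
  · have h : Submonoid.closure s ≤ (Submonoid.closure c).topologicalClosure :=
      Submonoid.closure_le.2 fun x hx => _root_.closure_mono Submonoid.subset_closure (hsc hx)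
    exact h

namespace UnivCStar

variable {A B : Type u} [CStarAlgebra A] [CStarAlgebra B]

/-- Polynomials in the two copies are dense, and they lie in the linear span of the words in a
separable set. -/
lemma separableSpace_univ (S : Set (A × B × ℝ)) [TopologicalSpace.SeparableSpace A]
    [TopologicalSpace.SeparableSpace B] : TopologicalSpace.SeparableSpace (Univ S) := by
  have hl : Continuous (inl S) := starHom_continuous (inl S : A →⋆ₙₐ[ℂ] Univ S)
  have hr : Continuous (inr S) := starHom_continuous (inr S : B →⋆ₙₐ[ℂ] Univ S)
  have hX : TopologicalSpace.IsSeparable (Set.range (inl S) ∪ Set.range (inr S)) :=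
    (TopologicalSpace.isSeparable_range hl).union (TopologicalSpace.isSeparable_range hr)
  have hspan := (Submonoid.isSeparable_closure hX).span (R := ℂ)
  rw [← Algebra.adjoin_eq_span] at hspan
  have hsub : Set.range (polyEval (inl S) (inr S)) ⊆
      (Algebra.adjoin ℂ (Set.range (inl S) ∪ Set.range (inr S)) : Set (Univ S)) := by
    rintro _ ⟨x, rfl⟩
    induction x using FreeAlgebra.induction with
    | grade0 r => rw [AlgHom.commutes]; exact Subalgebra.algebraMap_mem _ r
    | grade1 c =>
      rcases c with a | b
      · rw [polyEval_inl]; exact Algebra.subset_adjoin (Or.inl ⟨a, rfl⟩)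
      · rw [polyEval_inr]; exact Algebra.subset_adjoin (Or.inr ⟨b, rfl⟩)
    | mul p q hp hq => rw [map_mul]; exact mul_mem hp hq
    | add p q hp hq => rw [map_add]; exact add_mem hp hq
  have h2 := (hspan.mono hsub).closure
  rw [(dense_polyEval S).closure_range] at h2
  exact TopologicalSpace.isSeparable_univ_iff.1 h2

end UnivCStar

open UnivCStar

section

variable {A B : Type u} [CStarAlgebra A] [CStarAlgebra B]

@[simp] lemma softQuotientMap_inl (G : Set A) (H : Set B) {ε : ℝ} (hε : 0 < ε) (a : A) :
    softQuotientMap G H hε (inl _ a) = inl _ a := lift_inl _ _ _ a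

@[simp] lemma softQuotientMap_inr (G : Set A) (H : Set B) {ε : ℝ} (hε : 0 < ε) (b : B) :
    softQuotientMap G H hε (inr _ b) = inr _ b := lift_inr _ _ _ b

lemma satisfies_softRelations_mono (G : Set A) (H : Set B) {ε δ : ℝ} (hε : 0 < ε) (h : ε ≤ δ) :
    Satisfies (softRelations G H δ) (inl (softRelations G H ε)) (inr (softRelations G H ε)) := by
  rintro a b r ⟨ha, hb, hr⟩
  obtain rfl : r = δ := hr
  refine (satisfies_inl_inr (softRelations G H ε) ?_ a b ε ⟨ha, hb, rfl⟩).trans h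
  rintro _ _ r ⟨-, -, hr⟩
  exact hε.le.trans_eq hr.symm

/-- The canonical map between soft tensor products with different tolerances. -/
def softMap (G : Set A) (H : Set B) {ε δ : ℝ} (hε : 0 < ε) (h : ε ≤ δ) :
    SoftTensor G H δ →⋆ₐ[ℂ] SoftTensor G H ε :=
  lift (inl _) (inr _) (satisfies_softRelations_mono G H hε h)

@[simp] lemma softMap_inl (G : Set A) (H : Set B) {ε δ : ℝ} (hε : 0 < ε) (h : ε ≤ δ) (a : A) :
    softMap G H hε h (inl _ a) = inl _ a := lift_inl _ _ _ a

@[simp] lemma softMap_inr (G : Set A) (H : Set B) {ε δ : ℝ} (hε : 0 < ε) (h : ε ≤ δ) (b : B) :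
    softMap G H hε h (inr _ b) = inr _ b := lift_inr _ _ _ b

lemma softMap_softMap (G : Set A) (H : Set B) {ε δ γ : ℝ} (hε : 0 < ε) (hδ : 0 < δ) (h : ε ≤ δ)
    (h' : δ ≤ γ) (x : SoftTensor G H γ) :
    softMap G H hε h (softMap G H hδ h' x) = softMap G H hε (h.trans h') x := by
  have : (softMap G H hε h).comp (softMap G H hδ h') = softMap G H hε (h.trans h') :=
    hom_ext (by simp) (by simp)
  exact DFunLike.congr_fun this x

lemma softQuotientMap_softMap (G : Set A) (H : Set B) {ε δ : ℝ} (hε : 0 < ε) (h : ε ≤ δ)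
    (x : SoftTensor G H δ) :
    softQuotientMap G H hε (softMap G H hε h x) = softQuotientMap G H (hε.trans_le h) x := by
  have : (softQuotientMap G H hε).comp (softMap G H hε h)
      = softQuotientMap G H (hε.trans_le h) := hom_ext (by simp) (by simp)
  exact DFunLike.congr_fun this x

/-- The canonical map to the smaller tolerance is compatible with the maps to `A ⊗ B`, so it carries
a splitting to a splitting. -/
lemma SplitsUnitally.mono {G : Set A} {H : Set B} {ε δ : ℝ} {hδ : 0 < δ}
    (hs : SplitsUnitally G H hδ) (hε : 0 < ε) (h : ε ≤ δ) : SplitsUnitally G H hε := by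
  obtain ⟨σ, hσ⟩ := hs
  exact ⟨(softMap G H hε h).comp σ, fun x => by
    rw [StarAlgHom.comp_apply, softQuotientMap_softMap, hσ]⟩

lemma commute_inl_inr_commRelations (a : A) (b : B) :
    Commute (inl (commRelations A B) a) (inr (commRelations A B) b) := by
  have := satisfies_inl_inr (commRelations A B) (fun _ _ r (h : r = 0) => h.ge) a b 0 rfl
  exact sub_eq_zero.1 (norm_le_zero_iff.1 this)

lemma satisfies_commRelations {D : Type u} [CStarAlgebra D] {φ : A →⋆ₐ[ℂ] D} {ψ : B →⋆ₐ[ℂ] D}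
    (h : ∀ a b, Commute (φ a) (ψ b)) : Satisfies (commRelations A B) φ ψ := by
  rintro a b r hr
  obtain rfl : r = 0 := hr
  rw [(h a b).eq, sub_self, norm_zero]

end

end

/-! ### The sequence of soft tensor products, and splittings versus lifting. -/

noncomputable section

open UnivCStar

section

/-- The non-unital structure underlying that of the unital C*-algebra `Univ S`. -/
abbrev UnivCStar.univNonUnital {A B : Type u} [CStarAlgebra A] [CStarAlgebra B]
    (S : Set (A × B × ℝ)) : NonUnitalCStarAlgebra (Univ S) :=
  CStarAlgebra.toNonUnitalCStarAlgebra (Univ S)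

-- `HasUnitalLifting` forms ideals with the non-unital structure derived from the unital one; ideals
-- of `Univ S` are to use the same.
attribute [local instance] UnivCStar.univNonUnital

variable {A B : Type u} [CStarAlgebra A] [CStarAlgebra B]

/-- The sequence of tolerances `1 / (n + 1)`. -/
def tol (n : ℕ) : ℝ := 1 / ((n : ℝ) + 1)

lemma tol_pos (n : ℕ) : 0 < tol n := Nat.one_div_pos_of_nat

lemma tol_antitone : Antitone tol := fun _ _ h => Nat.one_div_le_one_div h

/-- The sequence starts at tolerance `1`, so `softMap` leads from `SoftTensor G H 1` to every term.
-/
lemma tol_le_one (n : ℕ) : tol n ≤ 1 := by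
  simpa [tol] using tol_antitone (Nat.zero_le n)

/-- The kernel of the map from `SoftTensor G H 1` to the soft tensor product of tolerance
`1 / (n + 1)`. -/
def softIdeal (G : Set A) (H : Set B) (n : ℕ) : ClosedIdeal (SoftTensor G H 1) :=
  ClosedIdeal.ker
    (softMap G H (tol_pos n) (tol_le_one n) : SoftTensor G H 1 →⋆ₙₐ[ℂ] SoftTensor G H (tol n))

lemma mem_softIdeal {G : Set A} {H : Set B} {n : ℕ} {x : SoftTensor G H 1} :
    x ∈ softIdeal G H n ↔ softMap G H (tol_pos n) (tol_le_one n) x = 0 := Iff.rfl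

lemma monotone_softIdeal (G : Set A) (H : Set B) : Monotone (softIdeal G H) := by
  intro n m h x hx
  rw [mem_softIdeal] at hx ⊢
  rw [← softMap_softMap G H (tol_pos m) (tol_pos n) (tol_antitone h) (tol_le_one n), hx, map_zero]

/-- The kernel of the map from `SoftTensor G H 1` to the maximal tensor product, presented as the
closure of the union of the ideals `softIdeal G H n`. -/
def softLimitIdeal (G : Set A) (H : Set B) : ClosedIdeal (SoftTensor G H 1) :=
  ClosedIdeal.closureUnion (softIdeal G H) (monotone_softIdeal G H)

/-- The map to `A ⊗ B` is continuous and factors through each tolerance. This inclusion of ideals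
suffices for it to descend to the limit quotient. -/
lemma softQuotientMap_eq_zero {G : Set A} {H : Set B} {x : SoftTensor G H 1}
    (hx : x ∈ softLimitIdeal G H) : softQuotientMap G H one_pos x = 0 := by
  have hx' : x ∈ closure (⋃ n, (softIdeal G H n : Set (SoftTensor G H 1))) :=
    ClosedIdeal.coe_closureUnion (softIdeal G H) (monotone_softIdeal G H) ▸ hx
  refine closure_minimal (t := {x | softQuotientMap G H one_pos x = 0})
    (Set.iUnion_subset fun n y hy => ?_) (isClosed_eq (starHom_continuous
      (softQuotientMap G H one_pos : SoftTensor G H 1 →⋆ₙₐ[ℂ] MaxTensor A B)) continuous_const) hx'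
  have hy' : softMap G H (tol_pos n) (tol_le_one n) y = 0 := hy
  change softQuotientMap G H one_pos y = 0
  rw [← softQuotientMap_softMap G H (tol_pos n) (tol_le_one n), hy', map_zero]

/-- The quotient by `softIdeal G H n` embeds isometrically in the soft tensor product of tolerance
`tol n`, where the commutator has norm at most `tol n`. Passing to the limit quotient only decreases
the norm, which is therefore `0`. -/
lemma commutator_mem_softLimitIdeal {G : Set A} {H : Set B} {a : A} {b : B}
    (ha : a ∈ G ∨ star a ∈ G) (hb : b ∈ H ∨ star b ∈ H) :
    inl (softRelations G H 1) a * inr _ b - inr _ b * inl _ a ∈ softLimitIdeal G H := by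
  set c := inl (softRelations G H 1) a * inr _ b - inr _ b * inl _ a with hc
  have hle : ∀ n, softIdeal G H n ≤ softLimitIdeal G H :=
    ClosedIdeal.le_of_eq_closure (ClosedIdeal.coe_closureUnion _ (monotone_softIdeal G H))
  have hbound : ∀ n, ‖(ClosedIdeal.Quot.mk c : (softLimitIdeal G H).Quot)‖ ≤ tol n := by
    intro n
    have h1 : ‖(ClosedIdeal.Quot.mk c : (softLimitIdeal G H).Quot)‖
        ≤ ‖(ClosedIdeal.Quot.mk c : (softIdeal G H n).Quot)‖ := by
      rw [← ClosedIdeal.Quot.factor_mk (hle n)]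
      exact NonUnitalStarAlgHom.norm_apply_le _ _
    have h2 : ‖(ClosedIdeal.Quot.mk c : (softIdeal G H n).Quot)‖
        = ‖softMap G H (tol_pos n) (tol_le_one n) c‖ :=
      (NonUnitalStarAlgHom.norm_map _ (ClosedIdeal.Quot.liftHom_ker_injective
        (softMap G H (tol_pos n) (tol_le_one n) :
          SoftTensor G H 1 →⋆ₙₐ[ℂ] SoftTensor G H (tol n))) (ClosedIdeal.Quot.mk c)).symm
    rw [h2, hc, map_sub, map_mul, map_mul, softMap_inl, softMap_inr] at h1
    refine h1.trans (satisfies_inl_inr (softRelations G H (tol n)) ?_ a b _ ⟨ha, hb, rfl⟩)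
    rintro _ _ r ⟨-, -, hr⟩
    exact (tol_pos n).le.trans_eq hr.symm
  have h0 : ‖(ClosedIdeal.Quot.mk c : (softLimitIdeal G H).Quot)‖ ≤ 0 :=
    ge_of_tendsto' tendsto_one_div_add_atTop_nhds_zero_nat hbound
  rw [norm_le_zero_iff, ← ClosedIdeal.Quot.mk_zero, ClosedIdeal.Quot.mk_eq_mk, sub_zero] at h0
  exact h0

/-- If the maximal tensor product is semiprojective, then the quotient maps from the soft tensor
products of small tolerance split. -/
lemma exists_splitsUnitally {G : Set A} {H : Set B} (hG : IsGeneratingSet G)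
    (hH : IsGeneratingSet H) (hT : HasUnitalLifting (MaxTensor A B)) :
    ∃ (ε : ℝ) (hε : 0 < ε), SplitsUnitally G H hε := by
  let J := softLimitIdeal G H
  have hJ : (J : Set (SoftTensor G H 1)) = closure (⋃ n, (softIdeal G H n : Set _)) :=
    ClosedIdeal.coe_closureUnion _ (monotone_softIdeal G H)
  let q : SoftTensor G H 1 →⋆ₐ[ℂ] J.Quot := ClosedIdeal.Quot.mkUnital J
  have hcomm : ∀ a b, Commute (q.comp (inl _) a) (q.comp (inr _) b) :=
    commute_of_generates₂ _ _ hG.2 hH.2 fun a b ha hb =>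
      ClosedIdeal.Quot.mk_eq_mk.2 (commutator_mem_softLimitIdeal ha hb)
  let φ : MaxTensor A B →⋆ₐ[ℂ] J.Quot := lift _ _ (satisfies_commRelations hcomm)
  obtain ⟨n, ψ, hψ⟩ := hT (SoftTensor G H 1) (softIdeal G H) J (monotone_softIdeal G H) hJ φ
  let i : (softIdeal G H n).Quot →⋆ₐ[ℂ] SoftTensor G H (tol n) :=
    StarAlgHom.ofMapOne (ClosedIdeal.Quot.liftHom _
      (softMap G H (tol_pos n) (tol_le_one n) : SoftTensor G H 1 →⋆ₙₐ[ℂ] SoftTensor G H (tol n))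
      fun _ h => h) (map_one (softMap G H (tol_pos n) (tol_le_one n)))
  let p : J.Quot →⋆ₐ[ℂ] MaxTensor A B :=
    StarAlgHom.ofMapOne (ClosedIdeal.Quot.liftHom _
      (softQuotientMap G H one_pos : SoftTensor G H 1 →⋆ₙₐ[ℂ] MaxTensor A B)
      fun _ h => softQuotientMap_eq_zero h) (map_one (softQuotientMap G H one_pos))
  have hpi : ∀ y, softQuotientMap G H (tol_pos n) (i y)
      = p (ClosedIdeal.Quot.factor (ClosedIdeal.le_of_eq_closure hJ n) y) := by
    intro y
    obtain ⟨x, rfl⟩ := ClosedIdeal.Quot.mk_surjective y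
    exact softQuotientMap_softMap G H (tol_pos n) (tol_le_one n) x
  -- This one-sided identity is enough: a lift of `φ` followed by `π_ε` equals `p` after `φ`. That
  -- `φ` is an isomorphism is not needed.
  have hpφ : p.comp φ = StarAlgHom.id ℂ _ := by
    refine hom_ext (fun a => ?_) fun b => ?_
    · rw [StarAlgHom.comp_apply, lift_inl]
      exact softQuotientMap_inl G H one_pos a
    · rw [StarAlgHom.comp_apply, lift_inr]
      exact softQuotientMap_inr G H one_pos b
  refine ⟨tol n, tol_pos n, i.comp ψ, fun x => ?_⟩
  rw [StarAlgHom.comp_apply, hpi, hψ]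
  exact DFunLike.congr_fun hpφ x

/-- The finite-or-null-sequence condition enters only here. Compactness will turn pointwise
smallness of commutators into smallness at a single stage. -/
lemma IsGeneratingSet.exists_isCompact {G : Set A} (hG : IsGeneratingSet G) :
    ∃ K : Set A, IsCompact K ∧ ∀ a, (a ∈ G ∨ star a ∈ G) → a ∈ K := by
  obtain ⟨K, hK, hGK⟩ : ∃ K : Set A, IsCompact K ∧ G ⊆ K := by
    rcases hG.1 with h | ⟨s, rfl, hs⟩
    · exact ⟨G, h.isCompact, subset_rfl⟩
    · exact ⟨_, hs.isCompact_insert_range, Set.subset_insert _ _⟩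
  refine ⟨K ∪ star '' K, hK.union (hK.image continuous_star), ?_⟩
  rintro a (ha | ha)
  · exact Or.inl (hGK ha)
  · exact Or.inr ⟨_, hGK ha, star_star a⟩

/-- If some quotient map from a soft tensor product splits, then the maximal tensor product inherits
the unital lifting property from the factors. -/
lemma SplitsUnitally.hasUnitalLifting {G : Set A} {H : Set B} (hG : IsGeneratingSet G)
    (hH : IsGeneratingSet H) (hA : HasUnitalLifting A) (hB : HasUnitalLifting B) {ε : ℝ}
    {hε : 0 < ε} (hs : SplitsUnitally G H hε) : HasUnitalLifting (MaxTensor A B) := by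
  intro E _ I J hI hJ φ
  obtain ⟨σ, hσ⟩ := hs
  obtain ⟨n₁, α, hα⟩ := hA E I J hI hJ (φ.comp (inl _))
  obtain ⟨n₂, β, hβ⟩ := hB E I J hI hJ (φ.comp (inr _))
  obtain ⟨K, hK, hGK⟩ := hG.exists_isCompact
  obtain ⟨L, hL, hHL⟩ := hH.exists_isCompact
  let N := max n₁ n₂
  have hα' : ∀ m, I n₁ ≤ I (N + m) := fun m => hI ((le_max_left _ _).trans (Nat.le_add_right N m))
  have hβ' : ∀ m, I n₂ ≤ I (N + m) := fun m => hI ((le_max_right _ _).trans (Nat.le_add_right N m))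
  let αm : ∀ m, A →⋆ₐ[ℂ] (I (N + m)).Quot := fun m =>
    (ClosedIdeal.Quot.factorUnital (hα' m)).comp α
  let βm : ∀ m, B →⋆ₐ[ℂ] (I (N + m)).Quot := fun m =>
    (ClosedIdeal.Quot.factorUnital (hβ' m)).comp β
  let J' := ClosedIdeal.le_of_eq_closure hJ
  have hαm : ∀ m a, ClosedIdeal.Quot.factor (J' (N + m)) (αm m a) = φ (inl _ a) := fun m a =>
    (ClosedIdeal.Quot.factor_factor (hα' m) (J' (N + m)) (α a)).trans (hα a)
  have hβm : ∀ m b, ClosedIdeal.Quot.factor (J' (N + m)) (βm m b) = φ (inr _ b) := fun m b =>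
    (ClosedIdeal.Quot.factor_factor (hβ' m) (J' (N + m)) (β b)).trans (hβ b)
  have hstep : ∀ {m k} (h : m ≤ k) (a : A) (b : B),
      ‖αm k a * βm k b - βm k b * αm k a‖ ≤ ‖αm m a * βm m b - βm m b * αm m a‖ := by
    intro m k h a b
    have hmk : I (N + m) ≤ I (N + k) := hI (Nat.add_le_add_left h N)
    have h1 : αm k a = ClosedIdeal.Quot.factor hmk (αm m a) :=
      (ClosedIdeal.Quot.factor_factor (hα' m) hmk (α a)).symm
    have h2 : βm k b = ClosedIdeal.Quot.factor hmk (βm m b) :=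
      (ClosedIdeal.Quot.factor_factor (hβ' m) hmk (β b)).symm
    rw [h1, h2, ← map_mul, ← map_mul, ← map_sub]
    exact NonUnitalStarAlgHom.norm_apply_le _ _
  -- Pairs whose lifted commutator is already below `ε` at stage `N + m`. The strict inequality
  -- makes these sets open, and they increase because `factor` is contractive.
  let U : ℕ → Set (A × B) := fun m =>
    {t | ‖αm m t.1 * βm m t.2 - βm m t.2 * αm m t.1‖ < ε}
  have hUopen : ∀ m, IsOpen (U m) := by
    intro m
    have h1 : Continuous (αm m) := starHom_continuous (αm m).toNonUnitalStarAlgHom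
    have h2 : Continuous (βm m) := starHom_continuous (βm m).toNonUnitalStarAlgHom
    exact isOpen_lt (by fun_prop) continuous_const
  have hUmono : Monotone U := fun m k h t ht => (hstep h t.1 t.2).trans_lt ht
  have hUcover : ∀ t, ∃ m, t ∈ U m := by
    rintro ⟨a, b⟩
    -- The commutator vanishes modulo `J`, because the copies of `A` and `B` commute in `A ⊗ B`; its
    -- representative therefore has small image at late stages.
    obtain ⟨x, hx⟩ := ClosedIdeal.Quot.mk_surjective (αm 0 a * βm 0 b - βm 0 b * αm 0 a)
    have hxJ : x ∈ J := by
      have : (ClosedIdeal.Quot.mk x : J.Quot) = 0 := by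
        rw [← ClosedIdeal.Quot.factor_mk (J' (N + 0)), hx, map_sub, map_mul, map_mul, hαm, hβm,
          ← map_mul, ← map_mul, (commute_inl_inr_commRelations a b).eq, sub_self]
      rwa [← ClosedIdeal.Quot.mk_zero, ClosedIdeal.Quot.mk_eq_mk, sub_zero] at this
    obtain ⟨m, hm⟩ := ClosedIdeal.exists_norm_mk_lt hI hJ hxJ hε
    refine ⟨m, ?_⟩
    have hle : I (N + 0) ≤ I (N + m) := hI (Nat.add_le_add_left (Nat.zero_le m) N)
    have h1 : αm m a = ClosedIdeal.Quot.factor hle (αm 0 a) :=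
      (ClosedIdeal.Quot.factor_factor (hα' 0) hle (α a)).symm
    have h2 : βm m b = ClosedIdeal.Quot.factor hle (βm 0 b) :=
      (ClosedIdeal.Quot.factor_factor (hβ' 0) hle (β b)).symm
    change ‖αm m a * βm m b - βm m b * αm m a‖ < ε
    rw [h1, h2, ← map_mul, ← map_mul, ← map_sub, ← hx, ClosedIdeal.Quot.factor_mk]
    exact hm _ (Nat.le_add_left m N)
  -- One stage serves the whole compact set `K ×ˢ L`, hence all the relations at once.
  obtain ⟨m, hm⟩ := (hK.prod hL).elim_directed_cover U hUopen
    (fun t _ => Set.mem_iUnion.2 (hUcover t)) hUmono.directed_le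
  have hsat : Satisfies (softRelations G H ε) (αm m) (βm m) := by
    rintro a b r ⟨ha, hb, hr⟩
    obtain rfl : r = ε := hr
    exact (hm (show (a, b) ∈ K ×ˢ L from ⟨hGK a ha, hHL b hb⟩)).le
  have hcomp : (ClosedIdeal.Quot.factorUnital (J' (N + m))).comp (lift (αm m) (βm m) hsat)
      = φ.comp (softQuotientMap G H hε) := by
    refine hom_ext (fun a => ?_) fun b => ?_
    · rw [StarAlgHom.comp_apply, StarAlgHom.comp_apply, lift_inl, softQuotientMap_inl]
      exact hαm m a
    · rw [StarAlgHom.comp_apply, StarAlgHom.comp_apply, lift_inr, softQuotientMap_inr]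
      exact hβm m b
  -- By `hcomp` this composite maps to `φ ∘ π_ε ∘ σ` in the quotient by `J`, which is `φ`.
  refine ⟨N + m, (lift (αm m) (βm m) hsat).comp σ, fun t => ?_⟩
  refine (DFunLike.congr_fun hcomp (σ t)).trans ?_
  rw [StarAlgHom.comp_apply, hσ]

end

/-! ### Conclusion. -/

variable {A B : Type u} [CStarAlgebra A] [CStarAlgebra B]

/-- If some quotient map from a soft tensor product of semiprojective algebras splits, then the
maximal tensor product is semiprojective. -/
lemma SplitsUnitally.isSemiprojective {G : Set A} {H : Set B} (hG : IsGeneratingSet G)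
    (hH : IsGeneratingSet H) (hA : IsSemiprojective A) (hB : IsSemiprojective B) {ε : ℝ}
    {hε : 0 < ε} (hs : SplitsUnitally G H hε) : IsSemiprojective (MaxTensor A B) := by
  have := hA.1
  have := hB.1
  refine (hs.hasUnitalLifting hG hH hA.hasUnitalLifting hB.hasUnitalLifting).isSemiprojective
    (separableSpace_univ _) fun D _ I J hI hJ φ => ?_
  -- The unit of `A ⊗ B` lies in the copy of `A`, so a non-unital lift `α` on `A` alone gives the
  -- projection `α 1` above `φ 1`.
  obtain ⟨n, α, hα⟩ := hA.2 D I J hI hJ (φ.comp (inl (commRelations A B)).toNonUnitalStarAlgHom)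
  refine ⟨n, α 1, ⟨?_, ?_⟩, ?_⟩
  · rw [IsIdempotentElem, ← map_mul, one_mul]
  · rw [IsSelfAdjoint, ← map_star, star_one]
  · rw [hα]
    exact congrArg φ (map_one (inl _))

end

theorem mainTheorem9 {A B : Type u} [CStarAlgebra A] [CStarAlgebra B]
    (hA : IsSemiprojective A) (hB : IsSemiprojective B)
    (G : Set A) (H : Set B) (hG : IsGeneratingSet G) (hH : IsGeneratingSet H) :
    ((∃ (ε : ℝ) (hε : 0 < ε), SplitsUnitally G H hε) ↔ IsSemiprojective (MaxTensor A B)) ∧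
    ((∃ ε₀ : ℝ, 0 < ε₀ ∧ ∀ (ε : ℝ) (hε : 0 < ε), ε ≤ ε₀ → SplitsUnitally G H hε) ↔
      IsSemiprojective (MaxTensor A B)) := by
  refine ⟨⟨?_, fun h => exists_splitsUnitally hG hH h.hasUnitalLifting⟩, ⟨?_, fun h => ?_⟩⟩
  · rintro ⟨ε, hε, hs⟩
    exact hs.isSemiprojective hG hH hA hB
  · rintro ⟨ε, hε, hs⟩
    exact (hs ε hε le_rfl).isSemiprojective hG hH hA hB
  · obtain ⟨ε, hε, hs⟩ := exists_splitsUnitally hG hH h.hasUnitalLifting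
    exact ⟨ε, hε, fun δ hδ hδε => hs.mono hδ hδε⟩
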